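/- **Theorem 3.3 (Global Existence).** Let $\mathscr P_2(\mathbb R)$ be the set of Borel probability measures on $\mathbb R$ with finite second moment. For $\mu\in\mathscr P_2(\mathbb R)$ call $X\in L^2(\mathbb R,\mu)$ *monotone* if the support $\Gamma$ of the push-forward $(\mathrm{id},X)\#\mu$ is a monotone set, i.e. $(m_1-m_2)(x_1-x_2)\ge 0$ for all $(m_1,x_1),(m_2,x_2)\in\Gamma$; let $\mathcal C=\mathcal C_\mu\subset L^2(\mathbb R,\mu)$ be the cone of monotone maps. Let $\bar\varrho\in\mathscr P_2(\mathbb R)$ and $\bar v\in L^2(\mathbb R,\bar\varrho)$. There exist $\mu\in\mathscr P_2(\mathbb R)$ and $\bar X\in\mathcal C_\mu$ with $\bar X\#\mu=\bar\varrho$. Moreover, for every $\mu\in\mathscr P_2(\mathbb R)$ and every $\bar X\in\mathcal C_\mu$ with $\bar X\#\mu=\bar\varrho$, the following holds. 1. $\bar X$ is the only element of $\mathcal C$ that pushes $\mu$ forward to $\bar\varrho$. 2. Put $\bar V:=\bar v\circ\bar X\in L^2(\mathbb R,\mu)$. For every $t\in\mathbb R$ the metric projection $X_t:=P_{\mathcal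 C}(\bar X+t\bar V)$, i.e. the point of $\mathcal C$ nearest to $\bar X+t\bar V$ in $L^2(\mathbb R,\mu)$, exists and is unique. Put $\varrho_t:=X_t\#\mu$. 3. For a.e. $t\in\mathbb R$, the map $t\mapsto X_t\in L^2(\mathbb R,\mu)$ is (strongly) differentiable at $t$, and $V_t:=\dot X_t$ is the orthogonal projection of $\bar V$ onto $H_{X_t}$, the closure in $L^2(\mathbb R,\mu)$ of $\{\varphi\circ X_t:\varphi\in C_c^\infty(\mathbb R)\}$. 4. There are functions $v_t:\mathbb R\to\mathbb R$ $(t\in\mathbb R)$ such that $v_t\in L^2(\mathbb R,\varrho_t)$ and $V_t=v_t\circ X_t$ $\mu$-a.e., for a.e. $t\in\mathbb R$, and such that $(\varrho_t,v_t)$ is a weak solution in $[0,\infty)\times\mathbb R$ of $$\partial_t\varrho+\partial_x(\varrho v)=0,\qquad \partial_t(\varrho v)+\partial_x(\varrho v^2)=0$$ with initial data $(\bar\varrho,\bar v)$. That is: $\varrho_t$ is a probability measure for all $t\ge0$ and $v_t\in L^2(\mathbb R,\varrho_t)$ for a.e. $t>0$; for all $\varphi\in C_c^\infty(\mathbb R^2)$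 and $k\in\{0,1,2\}$ the function $t\mapsto\int_{\mathbb R}\varphi(t,x)\,v_t(x)^k\,\varrho_t(dx)$ is integrable on $(0,\infty)$; and for all $\varphi\in C_c^\infty(\mathbb R^2)$ $$-\int_{\mathbb R}\varphi(0,x)\,\bar\varrho(dx)=\int_0^\infty\!\!\int_{\mathbb R}\big(\partial_t\varphi(t,x)+v_t(x)\,\partial_x\varphi(t,x)\big)\,\varrho_t(dx)\,dt,$$ $$-\int_{\mathbb R}\varphi(0,x)\,\bar v(x)\,\bar\varrho(dx)=\int_0^\infty\!\!\int_{\mathbb R}\big(\partial_t\varphi(t,x)+v_t(x)\,\partial_x\varphi(t,x)\big)\,v_t(x)\,\varrho_t(dx)\,dt.$$ -/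

import Mathlib

open MeasureTheory Set
open scoped ContDiff

noncomputable section

namespace PGD

/-- Borel probability measures on the real line with finite second moment. -/
structure IsP2 (ν : Measure ℝ) : Prop where
  isProbabilityMeasure : IsProbabilityMeasure ν
  secondMoment : Integrable (fun x : ℝ => x ^ 2) ν

/-- Monotone subsets of the plane. -/
def IsMonotoneSet (Γ : Set (ℝ × ℝ)) : Prop :=
  ∀ p ∈ Γ, ∀ q ∈ Γ, 0 ≤ (p.1 - q.1) * (p.2 - q.2)

/-- The transport plan induced by `X`: the push-forward of `μ` under `m ↦ (m, X m)`. -/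
def transportPlan (μ : Measure ℝ) (X : ℝ → ℝ) : Measure (ℝ × ℝ) :=
  μ.map (fun m => (m, X m))

/-- The cone of monotone maps in `L²(ℝ, μ)`: those `X` for which the (topological) support of
the induced transport plan is a monotone set. -/
def monotoneCone (μ : Measure ℝ) : Set (Lp ℝ 2 μ) :=
  {X | IsMonotoneSet (transportPlan μ X).support}

/-- `Z` is a metric projection of `Y` onto `C`: a point of `C` that realizes the distance. -/
def IsMetricProj {H : Type*} [NormedAddCommGroup H] (C : Set H) (Y Z : H) : Prop :=
  Z ∈ C ∧ ‖Y - Z‖ = ⨅ W : C, ‖Y - (W : H)‖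

/-- The Lagrangian velocity `v ∘ X` as an element of `L²(ℝ, μ)`, where `X` pushes `μ` forward to
`ν` and `v ∈ L²(ℝ, ν)`. -/
def lagrangianVelocity {μ ν : Measure ℝ} (X : Lp ℝ 2 μ) (hX : MeasurePreserving X μ ν)
    {v : ℝ → ℝ} (hv : MemLp v 2 ν) : Lp ℝ 2 μ :=
  (hv.comp_measurePreserving hX).toLp (v ∘ X)

/-- The subspace of all `φ ∘ X`, with `φ` smooth and compactly supported, in `L²(ℝ, μ)`. -/
def testCompositions {μ : Measure ℝ} (X : Lp ℝ 2 μ) : Submodule ℝ (Lp ℝ 2 μ) where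
  carrier := {W | ∃ φ : ℝ → ℝ, ContDiff ℝ ∞ φ ∧ HasCompactSupport φ ∧
    (W : ℝ → ℝ) =ᵐ[μ] fun m => φ (X m)}
  zero_mem' := ⟨0, contDiff_const, HasCompactSupport.zero, Lp.coeFn_zero ℝ 2 μ⟩
  add_mem' := by
    rintro W₁ W₂ ⟨φ₁, h₁, c₁, e₁⟩ ⟨φ₂, h₂, c₂, e₂⟩
    refine ⟨φ₁ + φ₂, h₁.add h₂, c₁.add c₂, ?_⟩
    filter_upwards [Lp.coeFn_add W₁ W₂, e₁, e₂] with m h k₁ k₂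
    exact h.trans (congrArg₂ (· + ·) k₁ k₂)
  smul_mem' := by
    rintro c W ⟨φ, h, hc, e⟩
    refine ⟨fun x => c * φ x, contDiff_const.mul h, hc.mul_left, ?_⟩
    filter_upwards [Lp.coeFn_smul c W, e] with m h k
    exact h.trans (congrArg (c * ·) k)

/-- The closure in `L²(ℝ, μ)` of the set of all `φ ∘ X`, with `φ` smooth and compactly
supported. -/
def closedSpan {μ : Measure ℝ} (X : Lp ℝ 2 μ) : Submodule ℝ (Lp ℝ 2 μ) :=
  (testCompositions X).topologicalClosure

instance {μ : Measure ℝ} (X : Lp ℝ 2 μ) : CompleteSpace (closedSpan X) :=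
  (Submodule.isClosed_topologicalClosure _).completeSpace_coe

/-- Test functions on `[0, ∞) × ℝ`: restrictions of smooth compactly supported functions
`(t, x) ↦ φ (t, x)` on the plane (they need not vanish at `t = 0`). -/
def IsTestFunction (φ : ℝ × ℝ → ℝ) : Prop :=
  ContDiff ℝ ∞ φ ∧ HasCompactSupport φ

/-- The partial derivative in time. -/
def dt (φ : ℝ × ℝ → ℝ) (t x : ℝ) : ℝ := deriv (fun s => φ (s, x)) t

/-- The partial derivative in space. -/
def dx (φ : ℝ × ℝ → ℝ) (t x : ℝ) : ℝ := deriv (fun y => φ (t, y)) x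

/-- `(ϱ, v)` is a weak (distributional) solution in `[0, ∞) × ℝ` of the pressureless gas dynamics
equations `∂ₜϱ + ∂ₓ(ϱv) = 0`, `∂ₜ(ϱv) + ∂ₓ(ϱv²) = 0` with initial data `(ϱ₀, v₀)`.
Here `ϱ t` are probability measures, and `v t` has finite kinetic energy for almost every `t`. -/
structure IsWeakSolution (ϱ : ℝ → Measure ℝ) (v : ℝ → ℝ → ℝ) (ϱ₀ : Measure ℝ) (v₀ : ℝ → ℝ) :
    Prop where
  isProbabilityMeasure : ∀ t, 0 ≤ t → IsProbabilityMeasure (ϱ t)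
  finiteEnergy : ∀ᵐ t ∂(volume.restrict (Ioi (0 : ℝ))), MemLp (v t) 2 (ϱ t)
  /-- The pairings of `ϱ`, `ϱv` and `ϱv²` with test functions are well defined. -/
  pairing : ∀ φ, IsTestFunction φ → ∀ k : ℕ, k ≤ 2 →
    IntegrableOn (fun t => ∫ x, φ (t, x) * v t x ^ k ∂(ϱ t)) (Ioi 0)
  continuityEquation : ∀ φ, IsTestFunction φ →
    -∫ x, φ (0, x) ∂ϱ₀ = ∫ t in Ioi (0 : ℝ), ∫ x, (dt φ t x + v t x * dx φ t x) ∂(ϱ t)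
  momentumEquation : ∀ ζ, IsTestFunction ζ →
    -∫ x, ζ (0, x) * v₀ x ∂ϱ₀ =
      ∫ t in Ioi (0 : ℝ), ∫ x, (dt ζ t x + v t x * dx ζ t x) * v t x ∂(ϱ t)

end PGD

end

/-!
The projection onto a closed convex cone is 1-Lipschitz, so `X t` is a Lipschitz curve in the
Hilbert space `L²(μ)`, and by Rademacher's theorem it is differentiable at almost every `t`. There
both `V = deriv X t` and `-V` are tangent to the cone of monotone maps at `X t`, so `V` is
nondecreasing and nonincreasing on each level set of `X t`; being constant on the level sets, it is
a function `v t` of `X t`. Since `X t ± ε φ(X t)` is monotone for small `ε`, the residual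
`X₀ + t U - X t` of the projection, where `U` is the initial velocity, is orthogonal to all
`φ(X t)`. Differentiating this in `t` shows that `U - V` is orthogonal to them as well, i.e. `V` is
the projection of `U` onto `closedSpan (X t)`.

For the weak formulation, integrate the derivative of `⟪g, φ(t, X t)⟫` over `t > 0`. The choice
`g = 1` gives the continuity equation. The choice `g = U` gives the momentum equation, because
the material derivative of `φ(t, X t)` lies in `closedSpan (X t)`, where `U` may be replaced by
its projection `V`.
-/

noncomputable section

namespace PGD

open Filter Topology NNReal

section HilbertRademacher

variable {H : Type*} [NormedAddCommGroup H] [InnerProductSpace ℝ H] {X : ℝ → H} {K : ℝ≥0}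

theorem eq_of_lipschitzWith_of_ae_hasDerivAt_zero (hX : LipschitzWith K X)
    (h : ∀ᵐ t, HasDerivAt X 0 t) (a b : ℝ) : X a = X b := by
  obtain ⟨C, hC⟩ :=
    (hX.lipschitzOnWith (s := uIcc a b)).absolutelyContinuousOnInterval.const_of_ae_hasDerivAt_zero
      (h.mono fun _ ht _ => ht)
  rw [hC a left_mem_uIcc, hC b right_mem_uIcc]

theorem lipschitzWith_integral {w : ℝ → H} (hw : LocallyIntegrable w) (hK : ∀ᵐ t, ‖w t‖ ≤ K) :
    LipschitzWith K fun x => ∫ t in (0 : ℝ)..x, w t := by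
  have hi (x y : ℝ) : IntervalIntegrable w volume x y :=
    intervalIntegrable_iff.mpr <|
      (hw.integrableOn_isCompact isCompact_uIcc).mono_set uIoc_subset_uIcc
  refine LipschitzWith.of_dist_le_mul fun x y => ?_
  rw [dist_eq_norm, intervalIntegral.integral_interval_sub_left (hi _ _) (hi _ _), Real.dist_eq]
  exact intervalIntegral.norm_integral_le_of_norm_le_const_ae (hK.mono fun t ht _ => ht)

theorem lipschitzWith_inner (hX : LipschitzWith K X) (e : H) :
    LipschitzWith (‖innerSL ℝ e‖₊ * K) fun t => inner ℝ e (X t) :=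
  (innerSL ℝ e).lipschitz.comp hX

theorem countable_of_orthonormal [SecondCountableTopology H] {ι : Type*} {b : ι → H}
    (hb : Orthonormal ℝ b) : Countable ι := by
  refine Pairwise.countable_of_isOpen_disjoint (s := fun i => Metric.ball (b i) (1 / 2)) ?_
    (fun i => Metric.isOpen_ball) (fun i => ⟨b i, Metric.mem_ball_self (by norm_num)⟩)
  intro i j hij
  refine Metric.ball_disjoint_ball ?_
  have h : ‖b i - b j‖ ^ 2 = 2 := by
    rw [norm_sub_sq_real, hb.1 i, hb.1 j, hb.2 hij]; norm_num
  rw [dist_eq_norm]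
  nlinarith [norm_nonneg (b i - b j)]

theorem norm_slope_le_of_lipschitzWith (hX : LipschitzWith K X) (s t : ℝ) :
    ‖slope X s t‖ ≤ K := by
  rw [slope_def_module, norm_smul, norm_inv, ← dist_eq_norm, ← dist_eq_norm, inv_mul_eq_div]
  exact div_le_of_le_mul₀ dist_nonneg K.2 (hX.dist_le_mul t s)

theorem sum_sq_deriv_inner_le (hX : LipschitzWith K X) {ι : Type*} {b : ι → H}
    (hb : Orthonormal ℝ b) {t : ℝ}
    (ht : ∀ i, DifferentiableAt ℝ (fun s => inner ℝ (b i) (X s)) t) (s : Finset ι) :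
    ∑ i ∈ s, deriv (fun s => inner ℝ (b i) (X s)) t ^ 2 ≤ (K : ℝ) ^ 2 := by
  have hslope (i : ι) : Tendsto (fun r => inner ℝ (b i) (slope X t r)) (𝓝[≠] t)
      (𝓝 (deriv (fun s => inner ℝ (b i) (X s)) t)) := by
    refine (hasDerivAt_iff_tendsto_slope.1 (ht i).hasDerivAt).congr fun r => ?_
    simp only [slope_def_module, inner_smul_right, inner_sub_right, smul_eq_mul]
  refine le_of_tendsto' (tendsto_finsetSum s fun i _ => (hslope i).pow 2) fun r => ?_
  calc ∑ i ∈ s, inner ℝ (b i) (slope X t r) ^ 2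
      = ∑ i ∈ s, ‖inner ℝ (b i) (slope X t r)‖ ^ 2 := by simp only [Real.norm_eq_abs, sq_abs]
    _ ≤ ‖slope X t r‖ ^ 2 := hb.sum_inner_products_le _
    _ ≤ (K : ℝ) ^ 2 :=
      pow_le_pow_left₀ (norm_nonneg _) (norm_slope_le_of_lipschitzWith hX t r) 2

theorem exists_hasSum_deriv_inner (hX : LipschitzWith K X) {ι : Type*} (b : HilbertBasis ι ℝ H)
    {t : ℝ} (ht : ∀ i, DifferentiableAt ℝ (fun s => inner ℝ (b i) (X s)) t) :
    ∃ w : H, HasSum (fun i => deriv (fun s => inner ℝ (b i) (X s)) t • b i) w ∧ ‖w‖ ≤ K ∧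
      ∀ i, HasDerivAt (fun s => inner ℝ (b i) (X s)) (inner ℝ (b i) w) t := by
  let a : ι → ℝ := fun i => deriv (fun s => inner ℝ (b i) (X s)) t
  have hsum (s : Finset ι) : ∑ i ∈ s, ‖a i‖ ^ 2 ≤ (K : ℝ) ^ 2 := by
    simpa only [Real.norm_eq_abs, sq_abs] using sum_sq_deriv_inner_le hX b.orthonormal ht s
  have ha : Memℓp a 2 := memℓp_gen' (C := (K : ℝ) ^ 2) fun s => by simpa using hsum s
  refine ⟨b.repr.symm ⟨a, ha⟩, b.hasSum_repr_symm ⟨a, ha⟩, ?_, fun i => ?_⟩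
  · rw [LinearIsometryEquiv.norm_map]
    exact lp.norm_le_of_forall_sum_le (by norm_num) K.2 fun s => by simpa using hsum s
  · rw [← b.repr_apply_apply, LinearIsometryEquiv.apply_symm_apply]
    exact (ht i).hasDerivAt

theorem exists_stronglyMeasurable_hasDerivAt_inner (hX : LipschitzWith K X) {ι : Type*}
    [Countable ι] (b : HilbertBasis ι ℝ H) :
    ∃ w : ℝ → H, StronglyMeasurable w ∧ (∀ᵐ t, ‖w t‖ ≤ K) ∧
      ∀ᵐ t, ∀ i, HasDerivAt (fun s => inner ℝ (b i) (X s)) (inner ℝ (b i) (w t)) t := by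
  let S (s : Finset ι) (t : ℝ) : H := ∑ i ∈ s, deriv (fun s => inner ℝ (b i) (X s)) t • b i
  have hSm (s : Finset ι) : StronglyMeasurable (S s) :=
    Finset.stronglyMeasurable_fun_sum _ fun i _ =>
      (measurable_deriv _).stronglyMeasurable.smul_const _
  have hlim : ∀ᵐ t, ∃ w : H, Tendsto (fun s => S s t) atTop (𝓝 w) ∧ ‖w‖ ≤ K ∧
      ∀ i, HasDerivAt (fun s => inner ℝ (b i) (X s)) (inner ℝ (b i) w) t := by
    filter_upwards [ae_all_iff.2 fun i => (lipschitzWith_inner hX (b i)).ae_differentiableAt_real]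
      with t ht using exists_hasSum_deriv_inner hX b ht
  obtain ⟨σ, hσ⟩ := (atTop : Filter (Finset ι)).exists_seq_tendsto
  obtain ⟨w, hw, hwlim⟩ := exists_stronglyMeasurable_limit_of_tendsto_ae
    (fun n => (hSm (σ n)).aestronglyMeasurable (μ := volume))
    (hlim.mono fun t ⟨l, hl, _⟩ => ⟨l, hl.comp hσ⟩)
  have heq : ∀ᵐ t, ‖w t‖ ≤ K ∧
      ∀ i, HasDerivAt (fun s => inner ℝ (b i) (X s)) (inner ℝ (b i) (w t)) t := by
    filter_upwards [hlim, hwlim] with t ⟨l, hl, hK, hder⟩ hwt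
    obtain rfl := tendsto_nhds_unique hwt (hl.comp hσ)
    exact ⟨hK, hder⟩
  exact ⟨w, hw, heq.mono fun _ h => h.1, heq.mono fun _ h => h.2⟩

theorem ae_differentiableAt_of_lipschitzWith_of_secondCountable [CompleteSpace H]
    [SecondCountableTopology H] (hX : LipschitzWith K X) : ∀ᵐ t, DifferentiableAt ℝ X t := by
  obtain ⟨ι, b, -⟩ := exists_hilbertBasis ℝ H
  have : Countable ι := countable_of_orthonormal b.orthonormal
  obtain ⟨w, hwm, hwK, hw⟩ := exists_stronglyMeasurable_hasDerivAt_inner hX b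
  have hwi : LocallyIntegrable w :=
    (locallyIntegrable_const (K : ℝ)).mono hwm.aestronglyMeasurable
      (hwK.mono fun t ht => by simpa using ht)
  have hprim : ∀ᵐ t, HasDerivAt (fun t => ∫ s in (0 : ℝ)..t, w s) (w t) t :=
    (LocallyIntegrable.ae_hasDerivAt_integral hwi).mono fun _ h => h 0
  have hrec (t : ℝ) : X t - ∫ s in (0 : ℝ)..t, w s = X 0 := by
    refine b.repr.injective (lp.ext (funext fun i => ?_))
    rw [b.repr_apply_apply, b.repr_apply_apply]
    have hzero : ∀ᵐ t, HasDerivAt (fun t => inner ℝ (b i) (X t - ∫ s in (0 : ℝ)..t, w s)) 0 t := by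
      filter_upwards [hw, hprim] with t hXt hwt
      simpa [inner_sub_right, Function.comp_def] using!
        (hXt i).sub ((innerSL ℝ (b i)).hasFDerivAt.comp_hasDerivAt t hwt)
    simpa using eq_of_lipschitzWith_of_ae_hasDerivAt_zero
      (lipschitzWith_inner (hX.sub (lipschitzWith_integral hwi hwK)) (b i)) hzero t 0
  filter_upwards [hprim] with t ht
  simpa only [← sub_eq_iff_eq_add.1 (hrec _)] using! (ht.const_add (X 0)).differentiableAt

theorem ae_differentiableAt_of_lipschitzWith [CompleteSpace H] (hX : LipschitzWith K X) :
    ∀ᵐ t, DifferentiableAt ℝ X t := by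
  -- The curve stays in the closed span of its range, which is separable.
  let S : Submodule ℝ H := (Submodule.span ℝ (range X)).topologicalClosure
  have hS : TopologicalSpace.IsSeparable (S : Set H) :=
    ((TopologicalSpace.isSeparable_range hX.continuous).span (R := ℝ)).closure
  have := hS.separableSpace
  have : SecondCountableTopology S := UniformSpace.secondCountable_of_separable S
  have : CompleteSpace S := (Submodule.isClosed_topologicalClosure _).completeSpace_coe
  let Y : ℝ → S := fun t =>
    ⟨X t, Submodule.le_topologicalClosure _ (Submodule.subset_span (mem_range_self t))⟩
  have hY : LipschitzWith K Y := hX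
  filter_upwards [ae_differentiableAt_of_lipschitzWith_of_secondCountable hY] with t ht
  exact S.subtypeL.differentiableAt.comp t ht

end HilbertRademacher

section MonotoneSets

theorem IsMonotoneSet.mono {Γ Δ : Set (ℝ × ℝ)} (hΔ : IsMonotoneSet Δ) (h : Γ ⊆ Δ) :
    IsMonotoneSet Γ :=
  fun p hp q hq => hΔ p (h hp) q (h hq)

theorem isMonotoneSet_closure {Γ : Set (ℝ × ℝ)} (hΓ : IsMonotoneSet Γ) :
    IsMonotoneSet (closure Γ) := by
  intro p hp q hq
  have hclosed : IsClosed {z : (ℝ × ℝ) × ℝ × ℝ | 0 ≤ (z.1.1 - z.2.1) * (z.1.2 - z.2.2)} :=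
    isClosed_le continuous_const (by fun_prop)
  have hpq : (p, q) ∈ closure (Γ ×ˢ Γ) := by
    rw [closure_prod_eq]
    exact ⟨hp, hq⟩
  exact closure_minimal (fun z hz => hΓ z.1 hz.1 z.2 hz.2) hclosed hpq

theorem isMonotoneSet_graphOn_iff {f : ℝ → ℝ} {s : Set ℝ} :
    IsMonotoneSet (s.graphOn f) ↔ MonotoneOn f s := by
  constructor
  · intro h a ha b hb hab
    rcases hab.eq_or_lt with rfl | hlt
    · exact le_rfl
    · have := h _ (mem_image_of_mem _ ha) _ (mem_image_of_mem _ hb)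
      exact sub_nonpos.1 (nonpos_of_mul_nonneg_right this (sub_neg.2 hlt))
  · rintro h _ ⟨a, ha, rfl⟩ _ ⟨b, hb, rfl⟩
    rcases le_total a b with hab | hab
    · exact mul_nonneg_of_nonpos_of_nonpos (sub_nonpos.2 hab) (sub_nonpos.2 (h ha hb hab))
    · exact mul_nonneg (sub_nonneg.2 hab) (sub_nonneg.2 (h hb ha hab))

theorem support_map_subset_closure_image {α β : Type*} [MeasurableSpace α] [TopologicalSpace β]
    [MeasurableSpace β] [OpensMeasurableSpace β] {μ : Measure α} {f : α → β} (hf : Measurable f)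
    {G : Set α} (hG : G ∈ ae μ) : (μ.map f).support ⊆ closure (f '' G) := by
  refine Measure.support_subset_of_isClosed isClosed_closure ?_
  rw [mem_ae_map_iff hf.aemeasurable isClosed_closure.measurableSet]
  exact mem_of_superset hG fun a ha => subset_closure (mem_image_of_mem f ha)

end MonotoneSets

section Rearrangement

variable {α : Type*} [LinearOrder α] {f g : α → ℝ} {G : Set α}

theorem inter_preimage_Iic_subset_or_subset (hf : MonotoneOn f G) (hg : MonotoneOn g G) (q : ℝ) :
    G ∩ f ⁻¹' Iic q ⊆ g ⁻¹' Iic q ∨ G ∩ g ⁻¹' Iic q ⊆ f ⁻¹' Iic q := by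
  refine or_iff_not_imp_left.2 fun hsub b ⟨hb, hgb⟩ => ?_
  obtain ⟨a, ⟨ha, hfa⟩, hga⟩ := not_subset.1 hsub
  have hlt : g b < g a := (mem_Iic.1 hgb).trans_lt (not_le.1 hga)
  have hba : b ≤ a := (not_le.1 fun hab => hlt.not_ge (hg ha hb hab)).le
  exact (hf hb ha hba).trans hfa

variable [MeasurableSpace α] {μ : Measure α} [IsFiniteMeasure μ]

theorem preimage_Iic_ae_eq_of_monotoneOn (hfm : Measurable f) (hgm : Measurable g) (hG : G ∈ ae μ)
    (hf : MonotoneOn f G) (hg : MonotoneOn g G) (h : μ.map f = μ.map g) (q : ℝ) :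
    f ⁻¹' Iic q =ᵐ[μ] g ⁻¹' Iic q := by
  have heq : μ (f ⁻¹' Iic q) = μ (g ⁻¹' Iic q) := by
    rw [← Measure.map_apply hfm measurableSet_Iic, h, Measure.map_apply hgm measurableSet_Iic]
  rcases inter_preimage_Iic_subset_or_subset hf hg q with hsub | hsub
  · refine ae_eq_of_ae_subset_of_measure_ge ?_ heq.ge (hfm measurableSet_Iic).nullMeasurableSet
      (measure_ne_top μ _)
    filter_upwards [hG] with a ha hfa using hsub ⟨ha, hfa⟩
  · refine (ae_eq_of_ae_subset_of_measure_ge ?_ heq.le (hgm measurableSet_Iic).nullMeasurableSet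
      (measure_ne_top μ _)).symm
    filter_upwards [hG] with a ha hga using hsub ⟨ha, hga⟩

theorem ae_eq_of_monotoneOn_of_map_eq (hfm : Measurable f) (hgm : Measurable g) (hG : G ∈ ae μ)
    (hf : MonotoneOn f G) (hg : MonotoneOn g G) (h : μ.map f = μ.map g) : f =ᵐ[μ] g := by
  have hq : ∀ᵐ a ∂μ, ∀ q : ℚ, f a ≤ q ↔ g a ≤ q :=
    ae_all_iff.2 fun q => (preimage_Iic_ae_eq_of_monotoneOn hfm hgm hG hf hg h q).mono
      fun _ ha => iff_of_eq ha
  filter_upwards [hq] with a ha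
  exact le_antisymm (le_of_forall_lt_rat_imp_le fun q hq => (ha q).2 hq.le)
    (le_of_forall_lt_rat_imp_le fun q hq => (ha q).1 hq.le)

end Rearrangement

section Cone

variable {μ : Measure ℝ} {X Y : Lp ℝ 2 μ}

theorem measurable_coeFn {Ω : Type*} [MeasurableSpace Ω] {ν : Measure Ω} (Z : Lp ℝ 2 ν) :
    Measurable Z :=
  (Lp.stronglyMeasurable Z).measurable

theorem mem_monotoneCone_iff : X ∈ monotoneCone μ ↔ ∃ G ∈ ae μ, MonotoneOn X G := by
  have hm : Measurable fun m => (m, X m) := measurable_id.prodMk (measurable_coeFn X)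
  constructor
  · intro h
    refine ⟨{m | (m, X m) ∈ (transportPlan μ X).support},
      mem_ae_of_mem_ae_map hm.aemeasurable Measure.support_mem_ae, ?_⟩
    exact isMonotoneSet_graphOn_iff.1 (IsMonotoneSet.mono h (image_subset_iff.2 fun _ hm => hm))
  · rintro ⟨G, hG, hmono⟩
    exact (isMonotoneSet_closure (isMonotoneSet_graphOn_iff.2 hmono)).mono
      (support_map_subset_closure_image hm hG)

theorem mem_monotoneCone_of_ae_eq {f : ℝ → ℝ} (h : X =ᵐ[μ] f) {G : Set ℝ} (hG : G ∈ ae μ)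
    (hf : MonotoneOn f G) : X ∈ monotoneCone μ :=
  mem_monotoneCone_iff.2 ⟨_, inter_mem hG h,
    (hf.mono inter_subset_left).congr fun _ hm => hm.2.symm⟩

theorem exists_subseq_ae_tendsto {Ω : Type*} [MeasurableSpace Ω] {ν : Measure Ω}
    {f : ℕ → Lp ℝ 2 ν} {Z : Lp ℝ 2 ν} (h : Tendsto f atTop (𝓝 Z)) :
    ∃ σ : ℕ → ℕ, StrictMono σ ∧ ∀ᵐ m ∂ν, Tendsto (fun n => f (σ n) m) atTop (𝓝 (Z m)) :=
  (tendstoInMeasure_of_tendsto_Lp h).exists_seq_tendsto_ae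

theorem isClosed_monotoneCone : IsClosed (monotoneCone μ) := by
  refine IsSeqClosed.isClosed fun f g hf hfg => ?_
  obtain ⟨σ, -, hσ⟩ := exists_subseq_ae_tendsto hfg
  choose G hG hmono using fun n => mem_monotoneCone_iff.1 (hf (σ n))
  refine mem_monotoneCone_iff.2 ⟨_, inter_mem (countable_iInter_mem.2 hG) hσ, ?_⟩
  intro a ha b hb hab
  exact le_of_tendsto_of_tendsto' ha.2 hb.2 fun n =>
    hmono n (mem_iInter.1 ha.1 n) (mem_iInter.1 hb.1 n) hab

theorem add_mem_monotoneCone (hX : X ∈ monotoneCone μ) (hY : Y ∈ monotoneCone μ) :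
    X + Y ∈ monotoneCone μ := by
  obtain ⟨G, hG, hXG⟩ := mem_monotoneCone_iff.1 hX
  obtain ⟨G', hG', hYG'⟩ := mem_monotoneCone_iff.1 hY
  exact mem_monotoneCone_of_ae_eq (Lp.coeFn_add X Y) (inter_mem hG hG')
    ((hXG.mono inter_subset_left).add (hYG'.mono inter_subset_right))

theorem smul_mem_monotoneCone (hX : X ∈ monotoneCone μ) {c : ℝ} (hc : 0 ≤ c) :
    c • X ∈ monotoneCone μ := by
  obtain ⟨G, hG, h⟩ := mem_monotoneCone_iff.1 hX
  exact mem_monotoneCone_of_ae_eq (Lp.coeFn_smul c X) hG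
    fun a ha b hb hab => mul_le_mul_of_nonneg_left (h ha hb hab) hc

theorem convex_monotoneCone : Convex ℝ (monotoneCone μ) :=
  fun _ hX _ hY _ _ ha hb _ =>
    add_mem_monotoneCone (smul_mem_monotoneCone hX ha) (smul_mem_monotoneCone hY hb)

theorem eq_of_mem_monotoneCone_of_map_eq [IsFiniteMeasure μ] (hX : X ∈ monotoneCone μ)
    (hY : Y ∈ monotoneCone μ) (h : μ.map X = μ.map Y) : X = Y := by
  obtain ⟨G, hG, hXG⟩ := mem_monotoneCone_iff.1 hX
  obtain ⟨G', hG', hYG'⟩ := mem_monotoneCone_iff.1 hY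
  exact Lp.ext (ae_eq_of_monotoneOn_of_map_eq (measurable_coeFn X) (measurable_coeFn Y)
    (inter_mem hG hG') (hXG.mono inter_subset_left) (hYG'.mono inter_subset_right) h)

end Cone

section Projection

variable {H : Type*} [NormedAddCommGroup H] {C : Set H}

theorem isMetricProj_self {Y : H} (hY : Y ∈ C) : IsMetricProj C Y Y := by
  have : Nonempty C := ⟨⟨Y, hY⟩⟩
  refine ⟨hY, le_antisymm ?_ ?_⟩
  · rw [sub_self, norm_zero]
    exact Real.iInf_nonneg fun _ => norm_nonneg _
  · exact ciInf_le ⟨0, forall_mem_range.2 fun _ => norm_nonneg _⟩ (⟨Y, hY⟩ : C)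

variable [InnerProductSpace ℝ H]

theorem isMetricProj_iff (hC : Convex ℝ C) {Y Z : H} :
    IsMetricProj C Y Z ↔ Z ∈ C ∧ ∀ W ∈ C, inner ℝ (Y - Z) (W - Z) ≤ 0 :=
  and_congr_right fun hZ => norm_eq_iInf_iff_real_inner_le_zero hC hZ

theorem IsMetricProj.inner_eq_zero (hC : Convex ℝ C) {Y Z W : H} (h : IsMetricProj C Y Z)
    (hadd : Z + W ∈ C) (hsub : Z - W ∈ C) : inner ℝ (Y - Z) W = 0 := by
  have hle := ((isMetricProj_iff hC).1 h).2
  have hneg := hle _ hsub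
  rw [sub_sub_cancel_left, inner_neg_right, neg_nonpos] at hneg
  exact le_antisymm (by simpa using hle _ hadd) hneg

theorem IsMetricProj.norm_sub_le (hC : Convex ℝ C) {Y Z Y' Z' : H} (h : IsMetricProj C Y Z)
    (h' : IsMetricProj C Y' Z') : ‖Z - Z'‖ ≤ ‖Y - Y'‖ := by
  obtain ⟨hZ, hYZ⟩ := (isMetricProj_iff hC).1 h
  obtain ⟨hZ', hYZ'⟩ := (isMetricProj_iff hC).1 h'
  have hle : ‖Z - Z'‖ * ‖Z - Z'‖ ≤ ‖Y - Y'‖ * ‖Z - Z'‖ := calc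
    ‖Z - Z'‖ * ‖Z - Z'‖ = inner ℝ (Z - Z') (Z - Z') := (real_inner_self_eq_norm_mul_norm _).symm
    _ = inner ℝ (Y - Y') (Z - Z') + (inner ℝ (Y - Z) (Z' - Z) + inner ℝ (Y' - Z') (Z - Z')) := by
      simp only [inner_sub_left, inner_sub_right]; ring
    _ ≤ inner ℝ (Y - Y') (Z - Z') := by linarith [hYZ Z' hZ', hYZ' Z hZ]
    _ ≤ ‖Y - Y'‖ * ‖Z - Z'‖ := real_inner_le_norm _ _
  rcases (norm_nonneg (Z - Z')).eq_or_lt with h0 | h0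
  · exact h0 ▸ norm_nonneg _
  · exact le_of_mul_le_mul_right hle h0

theorem IsMetricProj.eq (hC : Convex ℝ C) {Y Z Z' : H} (h : IsMetricProj C Y Z)
    (h' : IsMetricProj C Y Z') : Z = Z' := by
  simpa [sub_eq_zero] using h.norm_sub_le hC h'

theorem exists_isMetricProj_iff_eq [CompleteSpace H] (hC : Convex ℝ C) (hcl : IsClosed C)
    (hne : C.Nonempty) (Y : H) : ∃ Z, ∀ Z', IsMetricProj C Y Z' ↔ Z' = Z := by
  obtain ⟨Z, hZ⟩ := exists_norm_eq_iInf_of_complete_convex hne hcl.isComplete hC Y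
  exact ⟨Z, fun Z' => ⟨fun h => h.eq hC hZ, fun h => h ▸ hZ⟩⟩

theorem lipschitzWith_of_isMetricProj_line (hC : Convex ℝ C) {Y U : H} {X : ℝ → H}
    (hX : ∀ t, IsMetricProj C (Y + t • U) (X t)) : LipschitzWith ‖U‖₊ X := by
  refine LipschitzWith.of_dist_le_mul fun s t => ?_
  calc dist (X s) (X t) ≤ ‖(Y + s • U) - (Y + t • U)‖ := by
        rw [dist_eq_norm]; exact (hX s).norm_sub_le hC (hX t)
    _ = ‖U‖₊ * dist s t := by
        rw [add_sub_add_left_eq_sub, ← sub_smul, norm_smul, mul_comm, Real.dist_eq,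
          Real.norm_eq_abs, coe_nnnorm]

end Projection

section TangentCone

theorem mem_posTangentConeAt_of_hasDerivAt {E : Type*} [NormedAddCommGroup E] [NormedSpace ℝ E]
    {s : Set E} {X : ℝ → E} {V : E} {t : ℝ} (hX : ∀ r, X r ∈ s) (hV : HasDerivAt X V t) :
    V ∈ posTangentConeAt s (X t) := by
  refine mem_tangentConeAt_of_seq (𝓝[>] (0 : ℝ)) (fun h => h.toNNReal⁻¹)
    (fun h => X (t + h) - X t) ?_ (Eventually.of_forall fun h => ?_) ?_
  · have hcont : Tendsto (fun h => X (t + h)) (𝓝 0) (𝓝 (X t)) :=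
      hV.continuousAt.tendsto.comp (by simpa using (continuous_const_add t).tendsto 0)
    simpa using (hcont.sub_const (X t)).mono_left nhdsWithin_le_nhds
  · simpa using hX (t + h)
  · refine (hV.tendsto_slope_zero_right).congr' ?_
    filter_upwards [self_mem_nhdsWithin] with h hh
    rw [NNReal.smul_def, NNReal.coe_inv, Real.coe_toNNReal h (le_of_lt hh)]

theorem neg_mem_posTangentConeAt_of_hasDerivAt {E : Type*} [NormedAddCommGroup E]
    [NormedSpace ℝ E] {s : Set E} {X : ℝ → E} {V : E} {t : ℝ} (hX : ∀ r, X r ∈ s)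
    (hV : HasDerivAt X V t) : -V ∈ posTangentConeAt s (X t) := by
  have hrev : HasDerivAt (fun r => X (-r)) (-V) (-t) := by
    simpa using! HasDerivAt.scomp (-t) (by simpa using hV) (hasDerivAt_neg (-t))
  simpa using mem_posTangentConeAt_of_hasDerivAt (fun r => hX (-r)) hrev

variable {μ : Measure ℝ} {X V : Lp ℝ 2 μ}

theorem monotoneOn_levelSets_of_mem_posTangentConeAt
    (hV : V ∈ posTangentConeAt (monotoneCone μ) X) :
    ∃ G ∈ ae μ, ∀ a ∈ G, ∀ b ∈ G, a ≤ b → X a = X b → V a ≤ V b := by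
  obtain ⟨c, d, -, hd, hlim⟩ := mem_tangentConeAt_iff_exists_seq.1 hV
  obtain ⟨σ, hσ, hσlim⟩ := exists_subseq_ae_tendsto hlim
  have hG : ∀ᶠ n in atTop, ∃ G ∈ ae μ, MonotoneOn (fun m => X m + d (σ n) m) G := by
    filter_upwards [hσ.tendsto_atTop.eventually hd] with n hn
    obtain ⟨G, hG, hmono⟩ := mem_monotoneCone_iff.1 hn
    exact ⟨_, inter_mem hG (Lp.coeFn_add X (d (σ n))),
      (hmono.mono inter_subset_left).congr fun _ hm => hm.2⟩
  obtain ⟨N, hN⟩ := eventually_atTop.1 hG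
  choose! G hG hmono using hN
  have hsmul : ∀ᵐ m ∂μ, ∀ n, (c (σ n) • d (σ n)) m = c (σ n) * d (σ n) m :=
    ae_all_iff.2 fun n => Lp.coeFn_smul ((c (σ n) : ℝ)) (d (σ n))
  have hGN : ∀ᵐ m ∂μ, ∀ n, N ≤ n → m ∈ G n :=
    ae_all_iff.2 fun n => eventually_imp_distrib_left.2 (hG n)
  refine ⟨_, inter_mem (inter_mem hGN hσlim) hsmul, ?_⟩
  rintro a ⟨⟨ha, hta⟩, hsa⟩ b ⟨⟨hb, htb⟩, hsb⟩ hab hXab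
  refine le_of_tendsto_of_tendsto hta htb (eventually_atTop.2 ⟨N, fun n hn => ?_⟩)
  have hdab := hmono n hn (ha n hn) (hb n hn) hab
  simp only [hXab, add_le_add_iff_left] at hdab
  exact (hsa n).trans_le ((mul_le_mul_of_nonneg_left hdab (c (σ n)).2).trans_eq (hsb n).symm)

theorem const_on_levelSets_of_mem_posTangentConeAt
    (hV : V ∈ posTangentConeAt (monotoneCone μ) X)
    (hV' : -V ∈ posTangentConeAt (monotoneCone μ) X) :
    ∃ G ∈ ae μ, ∀ a ∈ G, ∀ b ∈ G, X a = X b → V a = V b := by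
  obtain ⟨G, hG, hle⟩ := monotoneOn_levelSets_of_mem_posTangentConeAt hV
  obtain ⟨G', hG', hge⟩ := monotoneOn_levelSets_of_mem_posTangentConeAt hV'
  refine ⟨_, inter_mem (inter_mem hG hG') (Lp.coeFn_neg V), ?_⟩
  intro a ha b hb hX
  wlog hab : a ≤ b generalizing a b
  · exact (this b hb a ha hX.symm (not_le.1 hab).le).symm
  have hneg := hge a ha.1.2 b hb.1.2 hab hX
  rw [ha.2, hb.2] at hneg
  exact le_antisymm (hle a ha.1.1 b hb.1.1 hab hX) (neg_le_neg_iff.1 hneg)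

theorem exists_measurable_comp_of_const_on_levelSets {Ω β γ : Type*} [MeasurableSpace Ω]
    [StandardBorelSpace Ω] [MeasurableSpace β] [MeasurableSpace.CountablySeparated β]
    [MeasurableSpace γ] [StandardBorelSpace γ] [Nonempty γ] {μ : Measure Ω} {X : Ω → β} {W : Ω → γ}
    (hX : Measurable X) (hW : Measurable W) {G : Set Ω} (hG : G ∈ ae μ)
    (h : ∀ a ∈ G, ∀ b ∈ G, X a = X b → W a = W b) :
    ∃ v : β → γ, Measurable v ∧ W =ᵐ[μ] v ∘ X := by
  obtain ⟨A, hAG, hA, hAμ⟩ : ∃ A ⊆ G, MeasurableSet A ∧ A ∈ ae μ := by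
    obtain ⟨T, hGT, hT, hTμ⟩ := exists_measurable_superset_of_null (mem_ae_iff.1 hG)
    exact ⟨Tᶜ, compl_subset_comm.1 hGT, hT.compl, compl_mem_ae_iff.2 hTμ⟩
  have := hA.standardBorel
  let f : A → β := fun a => X a
  have hf : Measurable f := hX.comp measurable_subtype_coe
  obtain ⟨g, hg⟩ : ∃ g : β → γ, (fun a : A => W a) = g ∘ f :=
    (Function.factorsThrough_iff _).1 fun a b hab => h a (hAG a.2) b (hAG b.2) hab
  -- Measurability descends along `f` only to its range, an analytic set, hence the extension `v`.
  have : MeasurableSpace.CountablySeparated (range f) :=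
    MeasurableSpace.Subtype.countablySeparated
  have hgr : Measurable (domRestrict (range f) g) :=
    hf.measurable_comp_iff_restrict.1 (hg ▸ hW.comp measurable_subtype_coe)
  obtain ⟨v, hv, hgv⟩ := Measurable.exists_eq_measurable_comp (f := ((↑) : range f → β)) hgr
  refine ⟨v, hv, ?_⟩
  filter_upwards [hAμ] with m hm
  exact (congrFun hg ⟨m, hm⟩).trans (congrFun hgv ⟨f ⟨m, hm⟩, mem_range_self _⟩)

end TangentCone

namespace IsTestFunction

variable {φ : ℝ × ℝ → ℝ}

theorem continuous (hφ : IsTestFunction φ) : Continuous φ := hφ.1.continuous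

theorem hasFDerivAt (hφ : IsTestFunction φ) (p : ℝ × ℝ) : HasFDerivAt φ (fderiv ℝ φ p) p :=
  (hφ.1.differentiable (by simp)).differentiableAt.hasFDerivAt

theorem dt_eq (hφ : IsTestFunction φ) (t x : ℝ) : dt φ t x = fderiv ℝ φ (t, x) (1, 0) :=
  ((hφ.hasFDerivAt (t, x)).comp_hasDerivAt t
    ((hasDerivAt_id t).prodMk (hasDerivAt_const t x))).deriv

theorem dx_eq (hφ : IsTestFunction φ) (t x : ℝ) : dx φ t x = fderiv ℝ φ (t, x) (0, 1) :=
  ((hφ.hasFDerivAt (t, x)).comp_hasDerivAt x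
    ((hasDerivAt_const x t).prodMk (hasDerivAt_id x))).deriv

theorem hasDerivAt_line (hφ : IsTestFunction φ) (t x v : ℝ) :
    HasDerivAt (fun h => φ (t + h, x + h * v)) (dt φ t x + v * dx φ t x) 0 := by
  have hline : HasDerivAt (fun h : ℝ => (t + h, x + h * v)) (1, v) 0 := by
    simpa using ((hasDerivAt_id (0 : ℝ)).const_add t).prodMk
      (((hasDerivAt_id (0 : ℝ)).mul_const v).const_add x)
  have hd := HasFDerivAt.comp_hasDerivAt_of_eq (0 : ℝ) (hφ.hasFDerivAt (t, x)) hline (by simp)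
  rwa [show ((1, v) : ℝ × ℝ) = (1, 0) + v • (0, 1) by simp, map_add, map_smul, ← hφ.dt_eq,
    ← hφ.dx_eq] at hd

theorem fderiv_apply (hφ : IsTestFunction φ) (e : ℝ × ℝ) :
    IsTestFunction fun p => fderiv ℝ φ p e :=
  ⟨(hφ.1.fderiv_right (m := ∞) (by simp)).clm_apply contDiff_const, hφ.2.fderiv_apply ℝ e⟩

theorem timeDeriv (hφ : IsTestFunction φ) : IsTestFunction fun p => dt φ p.1 p.2 := by
  simpa only [hφ.dt_eq] using hφ.fderiv_apply (1, 0)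

theorem spaceDeriv (hφ : IsTestFunction φ) : IsTestFunction fun p => dx φ p.1 p.2 := by
  simpa only [hφ.dx_eq] using hφ.fderiv_apply (0, 1)

theorem exists_lipschitzWith (hφ : IsTestFunction φ) : ∃ K : ℝ≥0, LipschitzWith K φ :=
  ContDiff.lipschitzWith_of_hasCompactSupport hφ.2 hφ.1 (by simp)

theorem exists_bound (hφ : IsTestFunction φ) : ∃ C : ℝ, ∀ p, |φ p| ≤ C :=
  hφ.2.exists_bound_of_continuous hφ.continuous

theorem exists_isCompact_time (hφ : IsTestFunction φ) :
    ∃ I : Set ℝ, IsCompact I ∧ ∀ t ∉ I, ∀ x, φ (t, x) = 0 :=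
  ⟨Prod.fst '' tsupport φ, hφ.2.isCompact.image continuous_fst, fun t ht x => by
    by_contra h
    exact ht ⟨(t, x), subset_tsupport _ h, rfl⟩⟩

end IsTestFunction

theorem isTestFunction_mul {χ ψ : ℝ → ℝ} (hχ : ContDiff ℝ ∞ χ) (hχc : HasCompactSupport χ)
    (hψ : ContDiff ℝ ∞ ψ) (hψc : HasCompactSupport ψ) :
    IsTestFunction fun p => χ p.1 * ψ p.2 := by
  refine ⟨(hχ.comp contDiff_fst).mul (hψ.comp contDiff_snd),
    HasCompactSupport.intro (hχc.isCompact.prod hψc.isCompact) fun p hp => ?_⟩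
  by_contra h
  exact hp ⟨subset_tsupport _ (left_ne_zero_of_mul h), subset_tsupport _ (right_ne_zero_of_mul h)⟩

section Multiplier

variable {Ω : Type*} [MeasurableSpace Ω] {μ : Measure Ω} {φ : ℝ × ℝ → ℝ}

theorem measurable_testFunction_comp (hφ : IsTestFunction φ) (t : ℝ) (X : Lp ℝ 2 μ) :
    Measurable fun m => φ (t, X m) :=
  hφ.continuous.measurable.comp (measurable_const.prodMk (measurable_coeFn X))

theorem memLp_top_testFunction_comp (hφ : IsTestFunction φ) (t : ℝ) (X : Lp ℝ 2 μ) :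
    MemLp (fun m => φ (t, X m)) ⊤ μ :=
  memLp_top_of_bound (measurable_testFunction_comp hφ t X).aestronglyMeasurable _
    (Eventually.of_forall fun _ => hφ.exists_bound.choose_spec _)

/-- The multiplication operator `W ↦ φ(t, X) W` on `L²(μ)`. In particular, `φ(t, X)` itself is the
image of the constant function `1` when `μ` is finite. -/
def multiplier (hφ : IsTestFunction φ) (t : ℝ) (X : Lp ℝ 2 μ) : Lp ℝ 2 μ →L[ℝ] Lp ℝ 2 μ :=
  (ContinuousLinearMap.mul ℝ ℝ).holderL μ ⊤ 2 2 (memLp_top_testFunction_comp hφ t X).toLp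

theorem coeFn_multiplier (hφ : IsTestFunction φ) (t : ℝ) (X W : Lp ℝ 2 μ) :
    multiplier hφ t X W =ᵐ[μ] fun m => φ (t, X m) * W m := by
  filter_upwards [(ContinuousLinearMap.mul ℝ ℝ).coeFn_holder (r := 2)
      (memLp_top_testFunction_comp hφ t X).toLp W,
    (memLp_top_testFunction_comp hφ t X).coeFn_toLp] with m hmul hφm
  exact hmul.trans (congrArg (· * W m) hφm)

theorem norm_multiplier_apply_le (hφ : IsTestFunction φ) {C : ℝ} (hC : ∀ p, |φ p| ≤ C) (t : ℝ)
    (X W : Lp ℝ 2 μ) : ‖multiplier hφ t X W‖ ≤ C * ‖W‖ := by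
  refine Lp.norm_le_mul_norm_of_ae_le_mul ?_
  filter_upwards [coeFn_multiplier hφ t X W] with m hm
  rw [hm, norm_mul]
  exact mul_le_mul_of_nonneg_right (hC _) (norm_nonneg _)

theorem multiplier_eq_zero (hφ : IsTestFunction φ) {t : ℝ} (ht : ∀ x, φ (t, x) = 0)
    (X W : Lp ℝ 2 μ) : multiplier hφ t X W = 0 := by
  refine Lp.ext ?_
  filter_upwards [coeFn_multiplier hφ t X W, Lp.coeFn_zero ℝ 2 μ] with m hm h0
  rw [hm, h0, ht, zero_mul, Pi.zero_apply]

variable [IsFiniteMeasure μ]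

theorem coeFn_multiplier_one (hφ : IsTestFunction φ) (t : ℝ) (X : Lp ℝ 2 μ) :
    multiplier hφ t X (Lp.const 2 μ 1) =ᵐ[μ] fun m => φ (t, X m) := by
  filter_upwards [coeFn_multiplier hφ t X (Lp.const 2 μ 1), Lp.coeFn_const 2 μ (1 : ℝ)] with m h h1
  rw [h, h1, Function.const_apply, mul_one]

theorem norm_multiplier_one_sub_le (hφ : IsTestFunction φ) {K : ℝ≥0} (hK : LipschitzWith K φ)
    (s t : ℝ) (X Y : Lp ℝ 2 μ) :
    ‖multiplier hφ s X (Lp.const 2 μ 1) - multiplier hφ t Y (Lp.const 2 μ 1)‖ ≤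
      K * (|s - t| * ‖Lp.const 2 μ (1 : ℝ)‖ + ‖X - Y‖) := by
  calc _ ≤ K * ‖|s - t| • Lp.const 2 μ (1 : ℝ) + |X - Y|‖ := by
        refine Lp.norm_le_mul_norm_of_ae_le_mul ?_
        filter_upwards [Lp.coeFn_sub (multiplier hφ s X (Lp.const 2 μ 1))
            (multiplier hφ t Y (Lp.const 2 μ 1)), coeFn_multiplier_one hφ s X,
          coeFn_multiplier_one hφ t Y, Lp.coeFn_add (|s - t| • Lp.const 2 μ (1 : ℝ)) |X - Y|,
          Lp.coeFn_smul |s - t| (Lp.const 2 μ (1 : ℝ)), Lp.coeFn_const 2 μ (1 : ℝ),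
          Lp.coeFn_abs (X - Y), Lp.coeFn_sub X Y] with m h hX hY hadd hsmul hone habs hsub
        rw [h, Pi.sub_apply, hX, hY, hadd, Pi.add_apply, hsmul, Pi.smul_apply, hone, habs, hsub,
          Function.const_apply, smul_eq_mul, mul_one, Pi.sub_apply, ← dist_eq_norm,
          Real.norm_of_nonneg (by positivity)]
        refine (hK.dist_le_mul _ _).trans (mul_le_mul_of_nonneg_left ?_ K.2)
        exact max_le_add_of_nonneg dist_nonneg dist_nonneg
    _ ≤ K * (|s - t| * ‖Lp.const 2 μ (1 : ℝ)‖ + ‖X - Y‖) := by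
        refine mul_le_mul_of_nonneg_left ((norm_add_le _ _).trans_eq ?_) K.2
        rw [norm_smul, Real.norm_eq_abs, abs_abs, norm_abs_eq_norm]

theorem continuous_multiplier_one (hφ : IsTestFunction φ) :
    Continuous fun p : ℝ × Lp ℝ 2 μ => multiplier hφ p.1 p.2 (Lp.const 2 μ 1) := by
  obtain ⟨K, hK⟩ := hφ.exists_lipschitzWith
  refine continuous_iff_continuousAt.2 fun p => tendsto_iff_norm_sub_tendsto_zero.2 ?_
  refine squeeze_zero (fun _ => norm_nonneg _)
    (fun q => norm_multiplier_one_sub_le hφ hK q.1 p.1 q.2 p.2) ?_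
  have hcont : Continuous fun q : ℝ × Lp ℝ 2 μ =>
      (K : ℝ) * (|q.1 - p.1| * ‖Lp.const 2 μ (1 : ℝ)‖ + ‖q.2 - p.2‖) := by fun_prop
  simpa using hcont.tendsto p

theorem norm_multiplier_sub_le_of_bound (hφ : IsTestFunction φ) (s t : ℝ) (X Y : Lp ℝ 2 μ)
    {W : Lp ℝ 2 μ} {M : ℝ} (hW : ∀ᵐ m ∂μ, ‖W m‖ ≤ M) :
    ‖multiplier hφ s X W - multiplier hφ t Y W‖ ≤
      M * ‖multiplier hφ s X (Lp.const 2 μ 1) - multiplier hφ t Y (Lp.const 2 μ 1)‖ := by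
  refine Lp.norm_le_mul_norm_of_ae_le_mul ?_
  filter_upwards [Lp.coeFn_sub (multiplier hφ s X W) (multiplier hφ t Y W),
    coeFn_multiplier hφ s X W, coeFn_multiplier hφ t Y W,
    Lp.coeFn_sub (multiplier hφ s X (Lp.const 2 μ 1)) (multiplier hφ t Y (Lp.const 2 μ 1)),
    coeFn_multiplier_one hφ s X, coeFn_multiplier_one hφ t Y, hW] with m h hX hY h1 hX1 hY1 hM
  rw [h, Pi.sub_apply, hX, hY, h1, Pi.sub_apply, hX1, hY1, ← sub_mul, norm_mul, mul_comm]
  exact mul_le_mul_of_nonneg_right hM (norm_nonneg _)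

variable [TopologicalSpace Ω] [BorelSpace Ω] [NormalSpace Ω] [μ.WeaklyRegular]

theorem continuous_multiplier (hφ : IsTestFunction φ) :
    Continuous fun p : Lp ℝ 2 μ × ℝ × Lp ℝ 2 μ => multiplier hφ p.2.1 p.2.2 p.1 := by
  obtain ⟨C, hC⟩ := hφ.exists_bound
  refine continuous_prod_of_dense_continuous_lipschitzWith _ C.toNNReal
    (Lp.boundedContinuousFunction_dense ℝ μ (p := 2) (by simp)) (fun W hW => ?_) fun p =>
    LipschitzWith.of_dist_le_mul fun W W' => ?_
  · obtain ⟨g, hg⟩ := Lp.mem_boundedContinuousFunction_iff.1 hW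
    have hWg : ∀ᵐ m ∂μ, ‖W m‖ ≤ ‖g‖ := by
      filter_upwards [ContinuousMap.coeFn_toAEEqFun μ g.toContinuousMap] with m hm
      rw [← hg, hm]
      exact g.norm_coe_le_norm m
    refine continuous_iff_continuousAt.2 fun p => tendsto_iff_norm_sub_tendsto_zero.2 ?_
    refine squeeze_zero (fun _ => norm_nonneg _)
      (fun q => norm_multiplier_sub_le_of_bound hφ q.1 p.1 q.2 p.2 hWg) ?_
    have hcont : Continuous fun q : ℝ × Lp ℝ 2 μ => ‖g‖ * ‖multiplier hφ q.1 q.2 (Lp.const 2 μ 1) -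
        multiplier hφ p.1 p.2 (Lp.const 2 μ 1)‖ :=
      ((continuous_multiplier_one hφ).sub continuous_const).norm.const_mul ‖g‖
    simpa using hcont.tendsto p
  · rw [dist_eq_norm, dist_eq_norm, ← map_sub]
    exact norm_multiplier_apply_le hφ (fun p => (hC p).trans (Real.le_coe_toNNReal C)) _ _ _

end Multiplier

section TransportDeriv

variable {Ω : Type*} [MeasurableSpace Ω] {μ : Measure Ω} {φ : ℝ × ℝ → ℝ}

theorem coeFn_add_smul (X V : Lp ℝ 2 μ) (h : ℝ) :
    ⇑(X + h • V) =ᵐ[μ] fun m => X m + h * V m := by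
  filter_upwards [Lp.coeFn_add X (h • V), Lp.coeFn_smul h V] with m hadd hsmul
  rw [hadd, Pi.add_apply, hsmul, Pi.smul_apply, smul_eq_mul]

theorem inner_eq_integral_mul_of_ae_eq (G : Lp ℝ 2 μ) {F : Lp ℝ 2 μ} {f : Ω → ℝ} (hF : F =ᵐ[μ] f) :
    inner ℝ G F = ∫ m, G m * f m ∂μ := by
  rw [L2.inner_def]
  exact integral_congr_ae (hF.mono fun m hm => (congrArg (inner ℝ (G m)) hm).trans (mul_comm _ _))

theorem lipschitzWith_line_mul {K : ℝ≥0} (hK : LipschitzWith K φ) (t x v c : ℝ) :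
    LipschitzWith (‖c‖₊ * (K * (1 + ‖v‖₊))) fun h => c * φ (t + h, x + h * v) := by
  have hline : LipschitzWith (1 + ‖v‖₊) fun h : ℝ => (t + h, x + h * v) := by
    refine LipschitzWith.of_dist_le_mul fun h k => ?_
    rw [Prod.dist_eq, dist_add_left, dist_add_left, Real.dist_eq, Real.dist_eq, ← sub_mul, abs_mul,
      mul_comm, NNReal.coe_add, NNReal.coe_one, coe_nnnorm, Real.norm_eq_abs, add_mul, one_mul]
    exact max_le_add_of_nonneg (abs_nonneg _) (by positivity)
  exact (lipschitzWith_smul c).comp (hK.comp hline)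

variable [IsFiniteMeasure μ]

/-- The material derivative `∂ₜφ(t, X) + ∂ₓφ(t, X) V`: the rate of change of `φ(t, X)` along a
curve that is at time `t` in position `X` with velocity `V`. -/
def transportDeriv (hφ : IsTestFunction φ) (t : ℝ) (X V : Lp ℝ 2 μ) : Lp ℝ 2 μ :=
  multiplier hφ.timeDeriv t X (Lp.const 2 μ 1) + multiplier hφ.spaceDeriv t X V

theorem coeFn_transportDeriv (hφ : IsTestFunction φ) (t : ℝ) (X V : Lp ℝ 2 μ) :
    transportDeriv hφ t X V =ᵐ[μ] fun m => dt φ t (X m) + V m * dx φ t (X m) := by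
  filter_upwards [Lp.coeFn_add (multiplier hφ.timeDeriv t X (Lp.const 2 μ 1))
      (multiplier hφ.spaceDeriv t X V), coeFn_multiplier_one hφ.timeDeriv t X,
    coeFn_multiplier hφ.spaceDeriv t X V] with m h ht hx
  rw [transportDeriv, h, Pi.add_apply, ht, hx, mul_comm]

theorem coeFn_multiplier_one_line (hφ : IsTestFunction φ) (t h : ℝ) (X V : Lp ℝ 2 μ) :
    multiplier hφ (t + h) (X + h • V) (Lp.const 2 μ 1) =ᵐ[μ]
      fun m => φ (t + h, X m + h * V m) := by
  filter_upwards [coeFn_multiplier_one hφ (t + h) (X + h • V), coeFn_add_smul X V h] with m hm hX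
  rw [hm, hX]

theorem hasDerivAt_inner_multiplier_line (hφ : IsTestFunction φ) (t : ℝ) (X V g : Lp ℝ 2 μ) :
    HasDerivAt (fun h : ℝ => inner ℝ g (multiplier hφ (t + h) (X + h • V) (Lp.const 2 μ 1)))
      (inner ℝ g (transportDeriv hφ t X V)) 0 := by
  obtain ⟨K, hK⟩ := hφ.exists_lipschitzWith
  have hint (h : ℝ) : Integrable (fun m => g m * φ (t + h, X m + h * V m)) μ := by
    refine (L2.integrable_inner g (multiplier hφ (t + h) (X + h • V) (Lp.const 2 μ 1))).congr ?_
    filter_upwards [coeFn_multiplier_one_line hφ t h X V] with m hm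
    rw [hm]
    exact mul_comm _ _
  have hbound : Integrable (fun m => |g m| * (K * (1 + |V m|))) μ := by
    have hV : MemLp (fun m => K * (1 + |V m|)) 2 μ :=
      ((memLp_const (1 : ℝ)).add (Lp.memLp V).abs).const_mul (K : ℝ)
    exact (Lp.memLp g).abs.integrable_mul hV
  have hmeas : Measurable fun m => g m * (dt φ t (X m) + V m * dx φ t (X m)) :=
    (measurable_coeFn g).mul ((measurable_testFunction_comp hφ.timeDeriv t X).add
      ((measurable_coeFn V).mul (measurable_testFunction_comp hφ.spaceDeriv t X)))
  have hlip (m : Ω) : LipschitzOnWith (Real.nnabs (|g m| * (K * (1 + |V m|))))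
      (fun h => g m * φ (t + h, X m + h * V m)) univ := by
    refine ((lipschitzWith_line_mul hK t (X m) (V m) (g m)).weaken (le_of_eq ?_)).lipschitzOnWith
    ext
    simp [abs_of_nonneg (add_nonneg zero_le_one (abs_nonneg (V m)))]
  simp only [inner_eq_integral_mul_of_ae_eq g (coeFn_multiplier_one_line hφ t _ X V),
    inner_eq_integral_mul_of_ae_eq g (coeFn_transportDeriv hφ t X V)]
  exact (hasDerivAt_integral_of_dominated_loc_of_lip univ_mem
    (Eventually.of_forall fun h => (hint h).aestronglyMeasurable) (hint 0)
    hmeas.aestronglyMeasurable (Eventually.of_forall hlip) hbound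
    (Eventually.of_forall fun m => (hφ.hasDerivAt_line t (X m) (V m)).const_mul (g m))).2

theorem hasDerivAt_inner_multiplier (hφ : IsTestFunction φ) {X : ℝ → Lp ℝ 2 μ} {V : Lp ℝ 2 μ}
    {t : ℝ} (hV : HasDerivAt X V t) (g : Lp ℝ 2 μ) :
    HasDerivAt (fun s => inner ℝ g (multiplier hφ s (X s) (Lp.const 2 μ 1)))
      (inner ℝ g (transportDeriv hφ t (X t) V)) t := by
  obtain ⟨K, hK⟩ := hφ.exists_lipschitzWith
  have hline := hasDerivAt_iff_isLittleO_nhds_zero.1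
    (hasDerivAt_inner_multiplier_line hφ t (X t) V g)
  have herr : (fun h => inner ℝ g (multiplier hφ (t + h) (X (t + h)) (Lp.const 2 μ 1)) -
      inner ℝ g (multiplier hφ (t + h) (X t + h • V) (Lp.const 2 μ 1))) =o[𝓝 0] fun h => h := by
    refine Asymptotics.IsBigO.trans_isLittleO
      (.of_bound (‖g‖ * K) (Eventually.of_forall fun h => ?_))
      (hasDerivAt_iff_isLittleO_nhds_zero.1 hV)
    rw [← inner_sub_right, mul_assoc, sub_sub]
    refine (norm_inner_le_norm _ _).trans (mul_le_mul_of_nonneg_left ?_ (norm_nonneg _))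
    simpa using norm_multiplier_one_sub_le hφ hK (t + h) (t + h) (X (t + h)) (X t + h • V)
  rw [hasDerivAt_iff_isLittleO_nhds_zero]
  refine (herr.add hline).congr_left fun h => ?_
  simp only [zero_add, add_zero, zero_smul]
  ring

end TransportDeriv

section EulerianRep

variable {Ω : Type*} [MeasurableSpace Ω] {μ : Measure Ω} {φ : ℝ × ℝ → ℝ} {X W Z : Lp ℝ 2 μ}
  {w z : ℝ → ℝ} {t : ℝ}

/-- The Lagrangian quantity `W ∈ L²(μ)`, attached to the particle labels, is represented on the
configuration `X` by the function `w ∈ L²(X#μ)` of the position: `W = w ∘ X`. -/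
structure IsEulerianRep (X W : Lp ℝ 2 μ) (w : ℝ → ℝ) : Prop where
  memLp : MemLp w 2 (μ.map X)
  ae_eq : W =ᵐ[μ] w ∘ X

namespace IsEulerianRep

theorem of_aestronglyMeasurable (hw : AEStronglyMeasurable w (μ.map X)) (h : W =ᵐ[μ] w ∘ X) :
    IsEulerianRep X W w :=
  ⟨(memLp_map_measure_iff hw (measurable_coeFn X).aemeasurable).2
    ((memLp_congr_ae h).1 (Lp.memLp W)), h⟩

theorem one [IsFiniteMeasure μ] (X : Lp ℝ 2 μ) :
    IsEulerianRep X (Lp.const 2 μ 1) fun _ => 1 :=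
  of_aestronglyMeasurable aestronglyMeasurable_const (Lp.coeFn_const 2 μ (1 : ℝ))

theorem multiplier (hW : IsEulerianRep X W w) (hφ : IsTestFunction φ) (t : ℝ) :
    IsEulerianRep X (multiplier hφ t X W) fun x => φ (t, x) * w x := by
  refine of_aestronglyMeasurable
    ((hφ.continuous.comp (.prodMk_right t)).aestronglyMeasurable.mul
      hW.memLp.aestronglyMeasurable) ?_
  filter_upwards [coeFn_multiplier hφ t X W, hW.ae_eq] with m hm hWm
  rw [hm, hWm, Function.comp_apply, Function.comp_apply]

theorem multiplier_one [IsFiniteMeasure μ] (X : Lp ℝ 2 μ) (hφ : IsTestFunction φ) (t : ℝ) :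
    IsEulerianRep X (PGD.multiplier hφ t X (Lp.const 2 μ 1)) fun x => φ (t, x) := by
  simpa only [mul_one] using (one X).multiplier hφ t

theorem add (hW : IsEulerianRep X W w) (hZ : IsEulerianRep X Z z) :
    IsEulerianRep X (W + Z) (w + z) := by
  refine ⟨hW.memLp.add hZ.memLp, ?_⟩
  filter_upwards [Lp.coeFn_add W Z, hW.ae_eq, hZ.ae_eq] with m hm hWm hZm
  rw [hm, Pi.add_apply, hWm, hZm]
  rfl

theorem transportDeriv [IsFiniteMeasure μ] (hW : IsEulerianRep X W w) (hφ : IsTestFunction φ)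
    (t : ℝ) : IsEulerianRep X (transportDeriv hφ t X W) fun x => dt φ t x + w x * dx φ t x := by
  simp only [mul_comm (w _)]
  exact (multiplier_one X hφ.timeDeriv t).add (hW.multiplier hφ.spaceDeriv t)

theorem inner_eq (hW : IsEulerianRep X W w) (hZ : IsEulerianRep X Z z) :
    inner ℝ W Z = ∫ x, w x * z x ∂(μ.map X) := by
  have hm : AEStronglyMeasurable (fun x => w x * z x) (μ.map X) :=
    hW.memLp.aestronglyMeasurable.mul hZ.memLp.aestronglyMeasurable
  rw [inner_eq_integral_mul_of_ae_eq W hZ.ae_eq,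
    integral_map (measurable_coeFn X).aemeasurable hm]
  exact integral_congr_ae (hW.ae_eq.mono fun m hWm => congrArg (· * z (X m)) hWm)

end IsEulerianRep

end EulerianRep

section ClosedSpan

variable {μ : Measure ℝ} {X Y W Z : Lp ℝ 2 μ}

theorem IsEulerianRep.mem_closedSpan [IsFiniteMeasure μ] {w : ℝ → ℝ} (hW : IsEulerianRep X W w) :
    W ∈ closedSpan X := by
  have hX := (measurable_coeFn X).aemeasurable (μ := μ)
  have : IsFiniteMeasure (μ.map X) := Measure.isFiniteMeasure_map μ X
  refine Metric.mem_closure_iff.2 fun ε hε => ?_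
  obtain ⟨g, hgc, hgs, hg⟩ := hW.memLp.exist_eLpNorm_sub_le (by simp) (by simp) (half_pos hε)
  have hgm : MemLp g 2 (μ.map X) := hgs.continuous.memLp_of_hasCompactSupport hgc
  have hgX : MemLp (g ∘ X) 2 μ := hgm.comp_of_map hX
  refine ⟨hgX.toLp, ⟨g, hgs, hgc, hgX.coeFn_toLp⟩, ?_⟩
  have hnorm : eLpNorm (⇑W - ⇑hgX.toLp) 2 μ = eLpNorm (w - g) 2 (μ.map X) := by
    rw [eLpNorm_map_measure (hW.memLp.sub hgm).aestronglyMeasurable hX]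
    exact eLpNorm_congr_ae (hW.ae_eq.sub hgX.coeFn_toLp)
  rw [Lp.dist_def, hnorm]
  exact (ENNReal.toReal_le_of_le_ofReal (half_pos hε).le hg).trans_lt (half_lt_self hε)

theorem exists_isEulerianRep_of_hasDerivAt {X : ℝ → Lp ℝ 2 μ} {V : Lp ℝ 2 μ} {t : ℝ}
    (hX : ∀ s, X s ∈ monotoneCone μ) (hV : HasDerivAt X V t) :
    ∃ v : ℝ → ℝ, IsEulerianRep (X t) V v := by
  obtain ⟨G, hG, hconst⟩ := const_on_levelSets_of_mem_posTangentConeAt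
    (mem_posTangentConeAt_of_hasDerivAt hX hV) (neg_mem_posTangentConeAt_of_hasDerivAt hX hV)
  obtain ⟨v, hv, hVv⟩ := exists_measurable_comp_of_const_on_levelSets (measurable_coeFn (X t))
    (measurable_coeFn V) hG hconst
  exact ⟨v, .of_aestronglyMeasurable hv.aestronglyMeasurable hVv⟩

theorem inner_eq_zero_of_mem_closedSpan (h : ∀ W ∈ testCompositions X, inner ℝ Z W = 0)
    (hW : W ∈ closedSpan X) : inner ℝ Z W = 0 := by
  have hle : closedSpan X ≤ (ℝ ∙ Z)ᗮ :=
    Submodule.topologicalClosure_minimal _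
      (fun W hW => Submodule.mem_orthogonal_singleton_iff_inner_right.2 (h W hW))
      (Submodule.isClosed_orthogonal _)
  exact Submodule.mem_orthogonal_singleton_iff_inner_right.1 (hle hW)

theorem monotoneOn_add_mul_of_lipschitzWith {f : ℝ → ℝ} {G : Set ℝ} (hf : MonotoneOn f G)
    {φ : ℝ → ℝ} {K : ℝ≥0} (hφ : LipschitzWith K φ) {c : ℝ} (hc : |c| * K ≤ 1) :
    MonotoneOn (fun m => f m + c * φ (f m)) G := by
  intro a ha b hb hab
  have hfab := hf ha hb hab
  have hle : c * (φ (f a) - φ (f b)) ≤ f b - f a := calc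
    c * (φ (f a) - φ (f b)) ≤ |c| * dist (φ (f a)) (φ (f b)) :=
      (le_abs_self _).trans_eq (abs_mul _ _)
    _ ≤ |c| * (K * dist (f a) (f b)) := by gcongr; exact hφ.dist_le_mul _ _
    _ ≤ dist (f a) (f b) := by
      rw [← mul_assoc]; exact mul_le_of_le_one_left dist_nonneg hc
    _ = f b - f a := by rw [dist_comm, Real.dist_eq, abs_of_nonneg (sub_nonneg.2 hfab)]
  change f a + c * φ (f a) ≤ f b + c * φ (f b)
  linarith

theorem add_smul_mem_monotoneCone (hX : X ∈ monotoneCone μ) {φ : ℝ → ℝ} {K : ℝ≥0}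
    (hφ : LipschitzWith K φ) (hW : W =ᵐ[μ] fun m => φ (X m)) {c : ℝ} (hc : |c| * K ≤ 1) :
    X + c • W ∈ monotoneCone μ := by
  obtain ⟨G, hG, hmono⟩ := mem_monotoneCone_iff.1 hX
  refine mem_monotoneCone_of_ae_eq ?_ hG (monotoneOn_add_mul_of_lipschitzWith hmono hφ hc)
  filter_upwards [coeFn_add_smul X W c, hW] with m hm hWm
  rw [hm, hWm]

theorem inner_sub_eq_zero_of_isMetricProj (h : IsMetricProj (monotoneCone μ) Y X)
    (hW : W ∈ closedSpan X) : inner ℝ (Y - X) W = 0 := by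
  refine inner_eq_zero_of_mem_closedSpan ?_ hW
  rintro W ⟨φ, hφ, hφc, hWφ⟩
  obtain ⟨K, hK⟩ := ContDiff.lipschitzWith_of_hasCompactSupport hφc hφ (by simp)
  obtain ⟨c, hc, hcK⟩ : ∃ c : ℝ, 0 < c ∧ c * K ≤ 1 :=
    ⟨((K : ℝ) + 1)⁻¹, by positivity, inv_mul_le_one_of_le₀ (by linarith) (by positivity)⟩
  have hadd : X + c • W ∈ monotoneCone μ :=
    add_smul_mem_monotoneCone h.1 hK hWφ (by rwa [abs_of_pos hc])
  have hsub : X - c • W ∈ monotoneCone μ := by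
    rw [sub_eq_add_neg, ← neg_smul]
    exact add_smul_mem_monotoneCone h.1 hK hWφ (by rwa [abs_neg, abs_of_pos hc])
  have hzero := h.inner_eq_zero convex_monotoneCone hadd hsub
  rw [real_inner_smul_right] at hzero
  exact (mul_eq_zero.1 hzero).resolve_left hc.ne'

end ClosedSpan

section Velocity

theorem hasDerivAt_inner_sub {H : Type*} [NormedAddCommGroup H] [InnerProductSpace ℝ H]
    {F R : ℝ → H} {R' : H} {t : ℝ} (hF : ContinuousAt F t) (hR : HasDerivAt R R' t) :
    HasDerivAt (fun s => inner ℝ (F s) (R s - R t)) (inner ℝ (F t) R') t := by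
  refine hasDerivAt_iff_tendsto_slope.2 <|
    ((hF.tendsto.mono_left nhdsWithin_le_nhds).inner hR.tendsto_slope).congr fun s => ?_
  rw [slope_def_module, slope_def_module, real_inner_smul_right, sub_self, inner_zero_right,
    sub_zero, smul_eq_mul]

variable {μ : Measure ℝ} [IsFiniteMeasure μ] {X : ℝ → Lp ℝ 2 μ} {Y U V : Lp ℝ 2 μ} {t : ℝ}

theorem inner_multiplier_one_sub_velocity_eq_zero
    (hX : ∀ s, IsMetricProj (monotoneCone μ) (Y + s • U) (X s)) (hV : HasDerivAt X V t)
    {φ : ℝ × ℝ → ℝ} (hφ : IsTestFunction φ) :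
    inner ℝ (multiplier hφ t (X t) (Lp.const 2 μ 1)) (U - V) = 0 := by
  obtain ⟨v, hv⟩ := exists_isEulerianRep_of_hasDerivAt (fun s => (hX s).1) hV
  set F : ℝ → Lp ℝ 2 μ := fun s => multiplier hφ s (X s) (Lp.const 2 μ 1)
  set R : ℝ → Lp ℝ 2 μ := fun s => Y + s • U - X s
  have horth (s : ℝ) : inner ℝ (R s) (F s) = 0 :=
    inner_sub_eq_zero_of_isMetricProj (hX s)
      (IsEulerianRep.multiplier_one (X s) hφ s).mem_closedSpan
  have hF : ContinuousAt F t :=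
    ContinuousAt.comp (f := fun s => (s, X s)) (continuous_multiplier_one hφ).continuousAt
      (continuousAt_id.prodMk hV.continuousAt)
  have hR : HasDerivAt R (U - V) t := by
    simpa using! (((hasDerivAt_id t).smul_const U).const_add Y).sub hV
  have hFderiv : HasDerivAt (fun s => inner ℝ (R t) (F s)) 0 t :=
    (hasDerivAt_inner_multiplier hφ hV (R t)).congr_deriv
      (inner_sub_eq_zero_of_isMetricProj (hX t) (hv.transportDeriv hφ t).mem_closedSpan)
  have hsum (s : ℝ) : inner ℝ (F s) (R s - R t) + inner ℝ (R t) (F s) = 0 := by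
    rw [inner_sub_right, real_inner_comm, horth, real_inner_comm, zero_sub, neg_add_cancel]
  have hderiv := (hasDerivAt_inner_sub hF hR).add hFderiv
  rw [add_zero] at hderiv
  exact hderiv.unique ((hasDerivAt_const t (0 : ℝ)).congr_of_eventuallyEq (.of_forall hsum))

theorem eq_starProjection_of_hasDerivAt
    (hX : ∀ s, IsMetricProj (monotoneCone μ) (Y + s • U) (X s)) (hV : HasDerivAt X V t) :
    V = (closedSpan (X t)).starProjection U := by
  obtain ⟨v, hv⟩ := exists_isEulerianRep_of_hasDerivAt (fun s => (hX s).1) hV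
  refine (Submodule.eq_starProjection_of_mem_of_inner_eq_zero hv.mem_closedSpan
    fun W hW => inner_eq_zero_of_mem_closedSpan ?_ hW).symm
  rintro W ⟨ψ, hψ, hψc, hWψ⟩
  let χ : ContDiffBump t := ⟨1, 2, one_pos, one_lt_two⟩
  have hφ := isTestFunction_mul χ.contDiff χ.hasCompactSupport hψ hψc
  have hW : W = multiplier hφ t (X t) (Lp.const 2 μ 1) := by
    refine Lp.ext (hWψ.trans ?_)
    filter_upwards [coeFn_multiplier_one hφ t (X t)] with m hm
    rw [hm, χ.one_of_mem_closedBall (Metric.mem_closedBall_self χ.rIn_pos.le), one_mul]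
  rw [hW, real_inner_comm]
  exact inner_multiplier_one_sub_velocity_eq_zero hX hV hφ

end Velocity

section WeakSolution

theorem integral_Ioi_deriv_of_lipschitzWith {f : ℝ → ℝ} {K : ℝ≥0} (hf : LipschitzWith K f)
    (hc : HasCompactSupport f) (a : ℝ) : ∫ t in Ioi a, deriv f t = -f a := by
  obtain ⟨b, hb⟩ := hc.isCompact.bddAbove
  have hzero {t : ℝ} (ht : b < t) : t ∉ tsupport f := fun h => (hb h).not_gt ht
  have hlt : max a b < max a b + 1 := lt_add_one _
  calc ∫ t in Ioi a, deriv f t = ∫ t in Ioc a (max a b + 1), deriv f t := by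
        refine setIntegral_eq_of_subset_of_forall_sdiff_eq_zero measurableSet_Ioi
          Ioc_subset_Ioi_self fun t ht => ?_
        have hbt : b < t := lt_of_not_ge fun h =>
          ht.2 ⟨ht.1, (h.trans (le_max_right a b)).trans hlt.le⟩
        exact image_eq_zero_of_notMem_tsupport fun h => hzero hbt (tsupport_deriv_subset h)
    _ = f (max a b + 1) - f a := by
        rw [← intervalIntegral.integral_of_le ((le_max_left a b).trans hlt.le)]
        exact hf.lipschitzOnWith.absolutelyContinuousOnInterval.integral_deriv_eq_sub
    _ = -f a := by
        rw [image_eq_zero_of_notMem_tsupport (hzero ((le_max_right a b).trans_lt hlt)), zero_sub]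

variable {Ω : Type*} [MeasurableSpace Ω] {μ : Measure Ω} [IsFiniteMeasure μ] {φ : ℝ × ℝ → ℝ}
  {X : ℝ → Lp ℝ 2 μ} {L : ℝ≥0}

theorem integrable_inner_multiplier [TopologicalSpace Ω] [BorelSpace Ω] [NormalSpace Ω]
    [μ.WeaklyRegular] (hφ : IsTestFunction φ) (hX : Continuous X) {A B : ℝ → Lp ℝ 2 μ}
    (hA : StronglyMeasurable A) (hB : StronglyMeasurable B) {a b : ℝ} (ha : ∀ t, ‖A t‖ ≤ a)
    (hb : ∀ t, ‖B t‖ ≤ b) :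
    Integrable fun t => inner ℝ (multiplier hφ t (X t) (A t)) (B t) := by
  obtain ⟨C, hC⟩ := hφ.exists_bound
  obtain ⟨I, hI, hφI⟩ := hφ.exists_isCompact_time
  have hmeas : StronglyMeasurable fun t => inner ℝ (multiplier hφ t (X t) (A t)) (B t) :=
    ((continuous_multiplier hφ).comp_stronglyMeasurable
      (hA.prodMk (stronglyMeasurable_id.prodMk hX.stronglyMeasurable))).inner hB
  have hbound (t : ℝ) : ‖inner ℝ (multiplier hφ t (X t) (A t)) (B t)‖ ≤ C * a * b := by
    have hC0 : 0 ≤ C := (abs_nonneg _).trans (hC 0)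
    have ha0 : 0 ≤ a := (norm_nonneg _).trans (ha t)
    calc _ ≤ ‖multiplier hφ t (X t) (A t)‖ * ‖B t‖ := norm_inner_le_norm _ _
      _ ≤ C * ‖A t‖ * ‖B t‖ := by gcongr; exact norm_multiplier_apply_le hφ hC t _ _
      _ ≤ C * a * b := by gcongr; exacts [ha t, hb t]
  refine IntegrableOn.integrable_of_forall_notMem_eq_zero (s := I) ?_ fun t ht => ?_
  · exact Measure.integrableOn_of_bounded hI.measure_lt_top.ne hmeas.aestronglyMeasurable
      (Eventually.of_forall hbound)
  · rw [multiplier_eq_zero hφ (hφI t ht), inner_zero_left]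

theorem lipschitzWith_multiplier_one (hφ : IsTestFunction φ) (hX : LipschitzWith L X) :
    ∃ K, LipschitzWith K fun t => multiplier hφ t (X t) (Lp.const 2 μ 1) := by
  obtain ⟨K, hK⟩ := hφ.exists_lipschitzWith
  refine ⟨K * (‖Lp.const 2 μ (1 : ℝ)‖₊ + L), LipschitzWith.of_dist_le_mul fun s t => ?_⟩
  rw [dist_eq_norm]
  calc _ ≤ K * (|s - t| * ‖Lp.const 2 μ (1 : ℝ)‖ + ‖X s - X t‖) :=
        norm_multiplier_one_sub_le hφ hK s t (X s) (X t)
    _ ≤ K * (|s - t| * ‖Lp.const 2 μ (1 : ℝ)‖ + L * |s - t|) := by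
        gcongr
        exact hX.norm_sub_le s t
    _ = _ := by
        rw [Real.dist_eq]
        push_cast
        ring

theorem integral_inner_transportDeriv (hφ : IsTestFunction φ) (hX : LipschitzWith L X)
    (g : Lp ℝ 2 μ) :
    ∫ t in Ioi (0 : ℝ), inner ℝ g (transportDeriv hφ t (X t) (deriv X t)) =
      -inner ℝ g (multiplier hφ 0 (X 0) (Lp.const 2 μ 1)) := by
  obtain ⟨K, hK⟩ := lipschitzWith_multiplier_one hφ hX
  obtain ⟨I, hI, hφI⟩ := hφ.exists_isCompact_time
  have hsupp : HasCompactSupport fun t => inner ℝ g (multiplier hφ t (X t) (Lp.const 2 μ 1)) :=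
    .intro hI fun t ht => by rw [multiplier_eq_zero hφ (hφI t ht), inner_zero_right]
  rw [← integral_Ioi_deriv_of_lipschitzWith (lipschitzWith_inner hK g) hsupp]
  refine integral_congr_ae (ae_restrict_of_ae ?_)
  filter_upwards [ae_differentiableAt_of_lipschitzWith hX] with t ht
  exact (hasDerivAt_inner_multiplier hφ ht.hasDerivAt g).deriv.symm

variable {v : ℝ → ℝ → ℝ} (hv : ∀ᵐ t, IsEulerianRep (X t) (deriv X t) (v t))
include hv

theorem continuityEquation_of_lipschitzWith (hX : LipschitzWith L X) (hφ : IsTestFunction φ) :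
    -∫ x, φ (0, x) ∂(μ.map (X 0)) =
      ∫ t in Ioi (0 : ℝ), ∫ x, (dt φ t x + v t x * dx φ t x) ∂(μ.map (X t)) := by
  have hone (t : ℝ) := IsEulerianRep.one (X t)
  have hinit := (hone 0).inner_eq (.multiplier_one (X 0) hφ 0)
  simp only [one_mul] at hinit
  rw [← hinit, ← integral_inner_transportDeriv hφ hX]
  refine integral_congr_ae (ae_restrict_of_ae ?_)
  filter_upwards [hv] with t ht
  simpa only [one_mul] using (hone t).inner_eq (ht.transportDeriv hφ t)

theorem integrableOn_pairing_of_lipschitzWith [TopologicalSpace Ω] [BorelSpace Ω] [NormalSpace Ω]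
    [μ.WeaklyRegular] (hX : LipschitzWith L X) (hφ : IsTestFunction φ) {k : ℕ} (hk : k ≤ 2) :
    IntegrableOn (fun t => ∫ x, φ (t, x) * v t x ^ k ∂(μ.map (X t))) (Ioi 0) := by
  have hV (t : ℝ) : ‖deriv X t‖ ≤ L := norm_deriv_le_of_lipschitz hX
  have hVm := stronglyMeasurable_deriv X
  have hone (t : ℝ) := IsEulerianRep.one (X t)
  have h1m : StronglyMeasurable fun _ : ℝ => Lp.const 2 μ (1 : ℝ) := stronglyMeasurable_const
  have hint {A B : ℝ → Lp ℝ 2 μ} {a b : ℝ} :=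
    integrable_inner_multiplier (A := A) (B := B) (a := a) (b := b) hφ hX.continuous
  interval_cases k
  · refine ((hint h1m h1m (fun _ => le_rfl) fun _ => le_rfl).congr ?_).integrableOn
    refine .of_forall fun t => ?_
    simpa only [mul_one, pow_zero] using ((hone t).multiplier hφ t).inner_eq (hone t)
  · refine ((hint hVm h1m hV fun _ => le_rfl).congr ?_).integrableOn
    filter_upwards [hv] with t ht
    simpa only [mul_one, pow_one] using (ht.multiplier hφ t).inner_eq (hone t)
  · refine ((hint hVm hVm hV hV).congr ?_).integrableOn
    filter_upwards [hv] with t ht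
    simpa only [mul_assoc, ← sq] using (ht.multiplier hφ t).inner_eq ht

end WeakSolution

section Momentum

variable {μ : Measure ℝ} {X : ℝ → Lp ℝ 2 μ} {L : ℝ≥0} {v : ℝ → ℝ → ℝ} {U : Lp ℝ 2 μ} {v₀ : ℝ → ℝ}

theorem momentumEquation_of_lipschitzWith [IsFiniteMeasure μ] {ζ : ℝ × ℝ → ℝ}
    (hv : ∀ᵐ t, IsEulerianRep (X t) (deriv X t) (v t))
    (hproj : ∀ᵐ t, deriv X t = (closedSpan (X t)).starProjection U)
    (hU : IsEulerianRep (X 0) U v₀) (hX : LipschitzWith L X) (hζ : IsTestFunction ζ) :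
    -∫ x, ζ (0, x) * v₀ x ∂(μ.map (X 0)) =
      ∫ t in Ioi (0 : ℝ), ∫ x, (dt ζ t x + v t x * dx ζ t x) * v t x ∂(μ.map (X t)) := by
  rw [← (IsEulerianRep.multiplier_one (X 0) hζ 0).inner_eq hU, real_inner_comm,
    ← integral_inner_transportDeriv hζ hX]
  refine integral_congr_ae (ae_restrict_of_ae ?_)
  filter_upwards [hv, hproj] with t ht htU
  have hD := ht.transportDeriv hζ t
  have horth := Submodule.starProjection_inner_eq_zero U _ hD.mem_closedSpan
  rw [← htU, inner_sub_left, sub_eq_zero] at horth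
  rw [horth, real_inner_comm]
  exact hD.inner_eq ht

theorem isWeakSolution_of_lipschitzWith [IsProbabilityMeasure μ] {ϱ₀ : Measure ℝ}
    (hv : ∀ᵐ t, IsEulerianRep (X t) (deriv X t) (v t))
    (hproj : ∀ᵐ t, deriv X t = (closedSpan (X t)).starProjection U)
    (hU : IsEulerianRep (X 0) U v₀) (hX : LipschitzWith L X) (hX₀ : μ.map (X 0) = ϱ₀) :
    IsWeakSolution (fun t => μ.map (X t)) v ϱ₀ v₀ where
  isProbabilityMeasure t _ :=
    Measure.isProbabilityMeasure_map (measurable_coeFn (X t)).aemeasurable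
  finiteEnergy := ae_restrict_of_ae (hv.mono fun _ ht => ht.memLp)
  pairing _ hφ _ := integrableOn_pairing_of_lipschitzWith hv hX hφ
  continuityEquation _ hφ := hX₀ ▸ continuityEquation_of_lipschitzWith hv hX hφ
  momentumEquation _ hζ := hX₀ ▸ momentumEquation_of_lipschitzWith hv hproj hU hX hζ

end Momentum

theorem exists_mem_monotoneCone_measurePreserving {ν : Measure ℝ} (hid : MemLp id 2 ν) :
    ∃ X ∈ monotoneCone ν, MeasurePreserving X ν ν := by
  have hX := hid.coeFn_toLp
  exact ⟨hid.toLp, mem_monotoneCone_of_ae_eq hX univ_mem (monotone_id.monotoneOn _),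
    measurable_coeFn _, (Measure.map_congr hX).trans Measure.map_id⟩

end PGD

end

open PGD in
theorem theorem3p3_general {μ ϱ₀ : Measure ℝ} [IsProbabilityMeasure μ] {v₀ : ℝ → ℝ}
    (hv₀ : MemLp v₀ 2 ϱ₀) {X₀ : Lp ℝ 2 μ} (hX₀C : X₀ ∈ monotoneCone μ)
    (hX₀ : MeasurePreserving X₀ μ ϱ₀) :
    (∀ Y ∈ monotoneCone μ, MeasurePreserving Y μ ϱ₀ → Y = X₀) ∧
      ∃ X : ℝ → Lp ℝ 2 μ,
        (∀ (t : ℝ) (Z : Lp ℝ 2 μ),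
          IsMetricProj (monotoneCone μ) (X₀ + t • lagrangianVelocity X₀ hX₀ hv₀) Z ↔ Z = X t) ∧
        (∀ᵐ t : ℝ, DifferentiableAt ℝ X t ∧
          deriv X t = (closedSpan (X t)).starProjection (lagrangianVelocity X₀ hX₀ hv₀)) ∧
        ∃ v : ℝ → ℝ → ℝ,
          (∀ᵐ t : ℝ, MemLp (v t) 2 (μ.map (X t)) ∧
            ((deriv X t : Lp ℝ 2 μ) : ℝ → ℝ) =ᵐ[μ] v t ∘ X t) ∧
          IsWeakSolution (fun t => μ.map (X t)) v ϱ₀ v₀ := by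
  refine ⟨fun Y hY hYϱ => eq_of_mem_monotoneCone_of_map_eq hY hX₀C
    (hYϱ.map_eq.trans hX₀.map_eq.symm), ?_⟩
  set U := lagrangianVelocity X₀ hX₀ hv₀
  choose X hX using fun t : ℝ => exists_isMetricProj_iff_eq convex_monotoneCone
    isClosed_monotoneCone ⟨X₀, hX₀C⟩ (X₀ + t • U)
  have hproj (t : ℝ) : IsMetricProj (monotoneCone μ) (X₀ + t • U) (X t) := (hX t _).2 rfl
  have hX0 : X₀ = X 0 := (hX 0 X₀).1 (by simpa using isMetricProj_self hX₀C)
  have hlip := lipschitzWith_of_isMetricProj_line convex_monotoneCone hproj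
  have hdiff : ∀ᵐ t : ℝ, DifferentiableAt ℝ X t ∧
      deriv X t = (closedSpan (X t)).starProjection U := by
    filter_upwards [ae_differentiableAt_of_lipschitzWith hlip] with t ht
    exact ⟨ht, eq_starProjection_of_hasDerivAt hproj ht.hasDerivAt⟩
  have hrep (t : ℝ) (ht : DifferentiableAt ℝ X t) :=
    exists_isEulerianRep_of_hasDerivAt (fun s => (hproj s).1) ht.hasDerivAt
  choose! v hv using hrep
  have hvae : ∀ᵐ t, IsEulerianRep (X t) (deriv X t) (v t) := hdiff.mono fun t ht => hv t ht.1
  have hU : IsEulerianRep X₀ U v₀ :=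
    ⟨hX₀.map_eq.symm ▸ hv₀, (hv₀.comp_measurePreserving hX₀).coeFn_toLp⟩
  exact ⟨X, hX, hdiff, v, hvae.mono fun t ht => ⟨ht.memLp, ht.ae_eq⟩,
    isWeakSolution_of_lipschitzWith hvae (hdiff.mono fun t ht => ht.2) (hX0 ▸ hU) hlip
      (hX0 ▸ hX₀.map_eq)⟩

theorem theorem3p3 (ϱ₀ : Measure ℝ) (hϱ₀ : PGD.IsP2 ϱ₀) (v₀ : ℝ → ℝ) (hv₀ : MemLp v₀ 2 ϱ₀) :
    -- some reference measure and monotone transport map exist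
    (∃ μ : Measure ℝ, PGD.IsP2 μ ∧ ∃ X₀ ∈ PGD.monotoneCone μ, MeasurePreserving X₀ μ ϱ₀) ∧
    ∀ (μ : Measure ℝ), PGD.IsP2 μ → ∀ X₀ ∈ PGD.monotoneCone μ,
      ∀ hX₀ : MeasurePreserving X₀ μ ϱ₀,
      -- the monotone transport map is unique
      (∀ Y ∈ PGD.monotoneCone μ, MeasurePreserving Y μ ϱ₀ → Y = X₀) ∧
      -- `X t` is the metric projection of `X₀ + t V₀` with `V₀ = v₀ ∘ X₀`
      ∃ X : ℝ → Lp ℝ 2 μ,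
        (∀ (t : ℝ) (Z : Lp ℝ 2 μ),
          PGD.IsMetricProj (PGD.monotoneCone μ)
            (X₀ + t • PGD.lagrangianVelocity X₀ hX₀ hv₀) Z ↔ Z = X t) ∧
        (∀ᵐ t : ℝ, DifferentiableAt ℝ X t ∧
          deriv X t = (PGD.closedSpan (X t)).starProjection
            (PGD.lagrangianVelocity X₀ hX₀ hv₀)) ∧
        ∃ v : ℝ → ℝ → ℝ,
          (∀ᵐ t : ℝ, MemLp (v t) 2 (μ.map (X t)) ∧
            ((deriv X t : Lp ℝ 2 μ) : ℝ → ℝ) =ᵐ[μ] v t ∘ X t) ∧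
          PGD.IsWeakSolution (fun t => μ.map (X t)) v ϱ₀ v₀ :=
  ⟨⟨ϱ₀, hϱ₀, PGD.exists_mem_monotoneCone_measurePreserving
      ((memLp_two_iff_integrable_sq aestronglyMeasurable_id).2 hϱ₀.secondMoment)⟩,
    fun _ hμ _ hX₀C hX₀ => haveI := hμ.isProbabilityMeasure; theorem3p3_general hv₀ hX₀C hX₀⟩
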